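/- Let $q:\mathbb R\to\mathbb R$ be locally integrable and suppose that $Ly=-y''+qy$, on its maximal domain in $L^2(\mathbb R)$ (all $y\in L^2(\mathbb R)$ with $y,y'$ locally absolutely continuous and $-y''+qy\in L^2(\mathbb R)$), is self-adjoint. Fix $\lambda_0\in\mathbb C$ with $\operatorname{Re}\lambda_0>0$ and $\operatorname{Im}\lambda_0>0$. For $\lambda\in\mathbb C$ let $c(\cdot,\lambda)$ and $s(\cdot,\lambda)$ be the solutions of $-y''+qy=\lambda^2y$ with $c(0,\lambda)=1$, $\dot c(0,\lambda)=0$ and $s(0,\lambda)=0$, $\dot s(0,\lambda)=1$ (the dot denotes $d/dx$), and let $$\mathfrak B_x(\lambda^2)=\begin{bmatrix} c(x,\lambda)&s(x,\lambda)\\ \dot c(x,\lambda)&\dot s(x,\lambda)\end{bmatrix}.$$ For $\operatorname{Im}\lambda>0$, $\operatorname{Re}\lambda\ne0$, let $m_+(\lambda)$ be the Weyl function, that is, the number for which $c(\cdot,\lambda)m_+(\lambda)+s(\cdot,\lambda)\in L^2(0,\infty)$. For $x_0\ge0$ let $e^+_{x_0}(\cdot,\lambda)$ be the solution of $-y''+qy=\lambda^2y$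 with $\int_{x_0}^\infty|e^+_{x_0}(x,\lambda)|^2\,dx=1$, its unimodular factor being fixed by the condition that its continuation to $x=0$ has positive derivative there. Put $$E_{x_0}=\begin{bmatrix} e^+_{x_0}(x_0,\lambda_0)&-e^+_{x_0}(x_0,-\bar\lambda_0)\\ \dot e^+_{x_0}(x_0,\lambda_0)&-\dot e^+_{x_0}(x_0,-\bar\lambda_0)\end{bmatrix},\qquad \tilde{\mathfrak A}_{x}(\lambda^2)=E_{x}^{-1}\,\mathfrak B_{x}(\lambda^2)\,E_0 .$$ Then there are functions $\tau(x)>0$ and $a(x)\in\mathbb C$ of $x>0$ such that $$\tilde{\mathfrak A}_x(\lambda_0^2)=\begin{bmatrix}\tau&a\tau\\0&\tau^{-1}\end{bmatrix},\qquad x>0,$$ and for every $x>0$ the functions $a$ and $\tau^{-2}$ are differentiable at $x$ with $(\tau^{-2})'(x)\neq0$, one has $c(x,\lambda_0)m_+(\lambda_0)+s(x,\lambda_0)\ne0$, and $$\frac{da}{d(\tau^{-2})}=\frac{a'(x)}{(\tau^{-2})'(x)}=\frac{\overline{c(x,\lambda_0)}\;\overline{m_+(\lambda_0)}+\overline{s(x,\lambda_0)}}{c(x,\lambda_0)\,m_+(\lambda_0)+s(x,\lambda_0)}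 .$$ -/

import Mathlib

open MeasureTheory Set

namespace SturmLiouville

/-- `y` solves `-y'' + q y = z y` on the real line: `y` is differentiable and `y'` is locally
absolutely continuous with `y'' = (q - z) y` almost everywhere (written in integrated form). -/
def IsSolution (q : ℝ → ℝ) (z : ℂ) (y : ℝ → ℂ) : Prop :=
  Differentiable ℝ y ∧
    ∀ x : ℝ, deriv y x = deriv y 0 + ∫ t in (0 : ℝ)..x, ((q t : ℂ) - z) * y t

/-- The graph in `L²(ℝ) × L²(ℝ)` of the maximal operator `y ↦ -y'' + q y`: the pairs `(f, g)` such
that `f` has a differentiable representative `y` whose derivative is locally absolutely continuous,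
with almost everywhere derivative `w`, and `g = -w + q y` almost everywhere. -/
def maximalGraph (q : ℝ → ℝ) :
    Submodule ℂ (Lp ℂ 2 (volume : Measure ℝ) × Lp ℂ 2 (volume : Measure ℝ)) where
  carrier := {p | ∃ y w : ℝ → ℂ, Differentiable ℝ y ∧ LocallyIntegrable w volume ∧
    (∀ x : ℝ, deriv y x = deriv y 0 + ∫ t in (0 : ℝ)..x, w t) ∧
    (p.1 : ℝ → ℂ) =ᵐ[volume] y ∧
    (p.2 : ℝ → ℂ) =ᵐ[volume] fun t => -w t + (q t : ℂ) * y t}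
  zero_mem' := by
    refine ⟨0, 0, differentiable_const 0, locallyIntegrable_zero, ?_, ?_, ?_⟩
    · intro x
      simp
    · exact Lp.coeFn_zero ℂ 2 volume
    · filter_upwards [Lp.coeFn_zero ℂ 2 (volume : Measure ℝ)] with t ht
      simpa using ht
  add_mem' := by
    rintro p p' ⟨y, w, hy, hw, hyw, hp1, hp2⟩ ⟨y', w', hy', hw', hyw', hp1', hp2'⟩
    refine ⟨y + y', w + w', hy.add hy', hw.add hw', ?_, ?_, ?_⟩
    · intro x
      have hd : ∀ t, deriv (y + y') t = deriv y t + deriv y' t :=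
        fun t => deriv_add (hy t) (hy' t)
      have hi : ∫ t in (0 : ℝ)..x, (w + w') t
          = (∫ t in (0 : ℝ)..x, w t) + ∫ t in (0 : ℝ)..x, w' t :=
        intervalIntegral.integral_add
          ((hw.integrableOn_isCompact isCompact_uIcc).intervalIntegrable)
          ((hw'.integrableOn_isCompact isCompact_uIcc).intervalIntegrable)
      rw [hd, hd, hi, hyw x, hyw' x]
      ring
    · filter_upwards [Lp.coeFn_add p.1 p'.1, hp1, hp1'] with t h1 h2 h3
      simp only [Prod.fst_add, h1, Pi.add_apply, h2, h3]
    · filter_upwards [Lp.coeFn_add p.2 p'.2, hp2, hp2'] with t h1 h2 h3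
      simp only [Prod.snd_add, h1, Pi.add_apply, h2, h3]
      ring
  smul_mem' := by
    rintro a p ⟨y, w, hy, hw, hyw, hp1, hp2⟩
    refine ⟨a • y, a • w, hy.const_smul a, hw.smul a, ?_, ?_, ?_⟩
    · intro x
      have hd : ∀ t, deriv (a • y) t = a * deriv y t := fun t => by
        rw [deriv_const_smul a (hy t), smul_eq_mul]
      have hi : ∫ t in (0 : ℝ)..x, (a • w) t = a * ∫ t in (0 : ℝ)..x, w t := by
        simpa using intervalIntegral.integral_const_mul (μ := volume) (a := 0) (b := x) a w
      rw [hd, hd, hi, hyw x]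
      ring
    · filter_upwards [Lp.coeFn_smul a p.1, hp1] with t h1 h2
      simp only [Prod.smul_fst, h1, Pi.smul_apply, h2]
    · filter_upwards [Lp.coeFn_smul a p.2, hp2] with t h1 h2
      simp only [Prod.smul_snd, h1, Pi.smul_apply, h2, smul_eq_mul]
      ring

/-- The operator `L y = -y'' + q y` in `L²(ℝ)`, on its maximal domain. -/
noncomputable def sturmLiouvilleOperator (q : ℝ → ℝ) :
    Lp ℂ 2 (volume : Measure ℝ) →ₗ.[ℂ] Lp ℂ 2 (volume : Measure ℝ) :=
  (maximalGraph q).toLinearPMap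

/-- `c(·, λ), s(·, λ)` are the solutions of `-y'' + q y = λ² y` with `c(0) = 1, c'(0) = 0` and
`s(0) = 0, s'(0) = 1`. -/
def IsFundamentalSystem (q : ℝ → ℝ) (c s : ℝ → ℂ → ℂ) : Prop :=
  ∀ l : ℂ,
    (IsSolution q (l ^ 2) (fun x => c x l) ∧ c 0 l = 1 ∧ deriv (fun x => c x l) 0 = 0) ∧
    (IsSolution q (l ^ 2) (fun x => s x l) ∧ s 0 l = 0 ∧ deriv (fun x => s x l) 0 = 1)

/-- The standard transfer matrix `𝔅_x(λ²)`. -/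
noncomputable def transferMatrix (c s : ℝ → ℂ → ℂ) (x : ℝ) (l : ℂ) : Matrix (Fin 2) (Fin 2) ℂ :=
  !![c x l, s x l; deriv (fun t => c t l) x, deriv (fun t => s t l) x]

/-- `m` is the Weyl function of the half-line `[0, ∞)`:
`c(·, λ) m(λ) + s(·, λ)` is square integrable on `(0, ∞)` whenever `Im λ > 0`, `Re λ ≠ 0`. -/
def IsWeylFunction (c s : ℝ → ℂ → ℂ) (m : ℂ → ℂ) : Prop :=
  ∀ l : ℂ, 0 < l.im → l.re ≠ 0 →
    MemLp (fun x => c x l * m l + s x l) 2 (volume.restrict (Ioi (0 : ℝ)))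

/-- `e x₀ x λ` is the value at `x` of the normalized solution `e_{x₀}^+(·, λ)`: the solution of
`-y'' + q y = λ² y` of unit norm in `L²[x₀, ∞)`, its unimodular factor being fixed by the condition
that its continuation to the origin has positive derivative there. -/
def IsNormalizedWeylSolution (q : ℝ → ℝ) (e : ℝ → ℝ → ℂ → ℂ) : Prop :=
  ∀ x₀ : ℝ, 0 ≤ x₀ → ∀ l : ℂ, 0 < l.im → l.re ≠ 0 →
    IsSolution q (l ^ 2) (fun x => e x₀ x l) ∧
    MemLp (fun x => e x₀ x l) 2 (volume.restrict (Ioi x₀)) ∧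
    ∫ x in Ioi x₀, ‖e x₀ x l‖ ^ 2 = 1 ∧
    ∃ ρ : ℝ, 0 < ρ ∧ deriv (fun x => e x₀ x l) 0 = (ρ : ℂ)

/-- The matrix with columns `(e, e')(x₀, λ₀)` and `-(e, e')(x₀, -conj λ₀)`, for `e = e_{x₀}^+`. -/
noncomputable def boundaryMatrix (e : ℝ → ℝ → ℂ → ℂ) (l₀ : ℂ) (x₀ : ℝ) :
    Matrix (Fin 2) (Fin 2) ℂ :=
  !![e x₀ x₀ l₀, -e x₀ x₀ (-(starRingEnd ℂ l₀));
    deriv (fun t => e x₀ t l₀) x₀, -deriv (fun t => e x₀ t (-(starRingEnd ℂ l₀))) x₀]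

/-- The normalized transfer matrix `𝔄̃_x(λ²)`, with normalization point `λ₀`. -/
noncomputable def normalizedTransferMatrix (c s : ℝ → ℂ → ℂ) (e : ℝ → ℝ → ℂ → ℂ) (l₀ : ℂ)
    (x : ℝ) (l : ℂ) : Matrix (Fin 2) (Fin 2) ℂ :=
  (boundaryMatrix e l₀ x)⁻¹ * transferMatrix c s x l * boundaryMatrix e l₀ 0

/-- `df/dg = d` at the parameter value `x`, for a curve `(g, f)`: both functions are differentiable
at `x`, `g'(x) ≠ 0`, and `d = f'(x) / g'(x)`. -/
def HasDerivWithRespectTo (f : ℝ → ℂ) (g : ℝ → ℝ) (d : ℂ) (x : ℝ) : Prop :=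
  ∃ (f' : ℂ) (g' : ℝ), HasDerivAt f f' x ∧ HasDerivAt g g' x ∧ g' ≠ 0 ∧ d = f' / (g' : ℂ)

end SturmLiouville

open Filter Topology ComplexConjugate

/-! Write `ψ = c m + s` at `λ₀`, `φ = c conj(m) + s`, `D = λ₀² - conj(λ₀²)` and `I x = ∫_x^∞ |ψ|²`.
Self-adjointness makes Wronskians of solutions that are square integrable at `+∞` vanish there.
Hence such solutions are multiples of `ψ`, and `D I = ψ' conj ψ - ψ conj ψ'`
(`IsSolution.integral_Ioi_mul`, `IsSolution.wronskian_star`). The normalization then forces `e_x(·,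
λ₀) = ψ / √(I x)` and `e_x(·, -conj λ₀) = conj ψ / √(I x)`.

The matrix `𝔅_x` carries Cauchy data at `0` to data at `x`. It sends the data of `ψ` to those of
`ψ`, so the first column is `(τ, 0)` with `τ² = I x / I 0`. It sends the data `(conj m, 1)` of `conj
ψ` at `0` to those of `φ`. With `J = W(φ, conj ψ)`, the linear dependence of `φ`, `ψ`, `conj ψ`
reads `ψ J + φ D I = D (I 0) conj ψ`, together with the same relation for derivatives. This gives
the second column, with `a = J / (D I)`. Since `J' = D φ conj ψ` and `I' = -|ψ|²`, the same relation
reduces `a'` to `(I 0) (conj ψ)² / I²`, whereas `(τ⁻²)' = (I 0) |ψ|² / I²`; the ratio is `conj ψ /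
ψ`. -/

namespace SturmLiouville

/-! ### Calculus of complex locally absolutely continuous functions -/

/-- `f` is a locally absolutely continuous function with almost everywhere derivative `g`, in
integrated form. -/
structure IsPrimitive (f g : ℝ → ℂ) : Prop where
  locallyIntegrable : LocallyIntegrable g volume
  eq_add_integral : ∀ x, f x = f 0 + ∫ t in (0 : ℝ)..x, g t

theorem _root_.MeasureTheory.LocallyIntegrable.intervalIntegrable {g : ℝ → ℂ}
    (hg : LocallyIntegrable g volume) (a b : ℝ) : IntervalIntegrable g volume a b :=
  (hg.integrableOn_isCompact isCompact_uIcc).intervalIntegrable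

/-- Increments of the primitive of `g` are dominated by those of the real primitive of `‖g‖`. -/
theorem _root_.IntervalIntegrable.absolutelyContinuousOnInterval_intervalIntegral_complex
    {g : ℝ → ℂ} {a b c : ℝ} (h : IntervalIntegrable g volume a b) (hc : c ∈ uIcc a b) :
    AbsolutelyContinuousOnInterval (fun x => ∫ t in c..x, g t) a b := by
  have hn := h.norm.absolutelyContinuousOnInterval_intervalIntegral hc
  rw [absolutelyContinuousOnInterval_iff] at hn ⊢
  intro ε hε
  obtain ⟨δ, hδ, H⟩ := hn ε hε
  refine ⟨δ, hδ, fun E hE hE' => lt_of_le_of_lt (Finset.sum_le_sum fun i hi => ?_) (H E hE hE')⟩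
  obtain ⟨h1, h2⟩ := hE.1 i hi
  have hi1 : ∀ x ∈ uIcc a b, IntervalIntegrable g volume c x := fun x hx =>
    h.mono_set (uIcc_subset_uIcc hc hx)
  rw [dist_eq_norm, dist_eq_norm, intervalIntegral.integral_interval_sub_left (hi1 _ h1) (hi1 _ h2),
    intervalIntegral.integral_interval_sub_left (hi1 _ h1).norm (hi1 _ h2).norm, Real.norm_eq_abs]
  exact intervalIntegral.norm_integral_le_abs_integral_norm

namespace IsPrimitive

variable {f g F G : ℝ → ℂ}

theorem absolutelyContinuousOnInterval (h : IsPrimitive f g) (x : ℝ) :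
    AbsolutelyContinuousOnInterval f 0 x := by
  have hc : AbsolutelyContinuousOnInterval (fun _ : ℝ => f 0) 0 x :=
    contDiffOn_const.absolutelyContinuousOnInterval
  have := hc.add ((h.locallyIntegrable.intervalIntegrable 0
    x).absolutelyContinuousOnInterval_intervalIntegral_complex (c := 0) (by simp))
  rw [funext h.eq_add_integral]
  exact this

theorem continuous (h : IsPrimitive f g) : Continuous f := by
  rw [funext h.eq_add_integral]
  exact continuous_const.add
    (intervalIntegral.continuous_primitive h.locallyIntegrable.intervalIntegrable 0)

theorem ae_hasDerivAt (h : IsPrimitive f g) : ∀ᵐ x, HasDerivAt f (g x) x := by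
  filter_upwards [LocallyIntegrable.ae_hasDerivAt_integral h.locallyIntegrable] with x hx
  rw [funext h.eq_add_integral]
  exact (hx 0).const_add _

theorem hasDerivAt (h : IsPrimitive f g) (hg : Continuous g) (x : ℝ) : HasDerivAt f (g x) x := by
  rw [funext h.eq_add_integral]
  exact (intervalIntegral.integral_hasDerivAt_right (hg.intervalIntegrable 0 x)
    (hg.stronglyMeasurableAtFilter _ _) hg.continuousAt).const_add _

theorem of_hasDerivAt (h : ∀ x, HasDerivAt f (g x) x) (hg : Continuous g) : IsPrimitive f g :=
  ⟨hg.locallyIntegrable, fun x => by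
    rw [intervalIntegral.integral_eq_sub_of_hasDerivAt (fun t _ => h t)
      (hg.intervalIntegrable 0 x)]
    ring⟩

theorem congr_right {g' : ℝ → ℂ} (h : IsPrimitive f g) (hg : g = g') : IsPrimitive f g' := hg ▸ h

theorem add (hf : IsPrimitive f g) (hF : IsPrimitive F G) :
    IsPrimitive (fun x => f x + F x) (fun x => g x + G x) :=
  ⟨hf.1.add hF.1, fun x => by
    rw [intervalIntegral.integral_add (hf.1.intervalIntegrable 0 x) (hF.1.intervalIntegrable 0 x),
      hf.2 x, hF.2 x]
    ring⟩

theorem sub (hf : IsPrimitive f g) (hF : IsPrimitive F G) :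
    IsPrimitive (fun x => f x - F x) (fun x => g x - G x) :=
  ⟨hf.1.sub hF.1, fun x => by
    rw [intervalIntegral.integral_sub (hf.1.intervalIntegrable 0 x) (hF.1.intervalIntegrable 0 x),
      hf.2 x, hF.2 x]
    ring⟩

theorem const_mul (a : ℂ) (hf : IsPrimitive f g) :
    IsPrimitive (fun x => a * f x) (fun x => a * g x) :=
  ⟨hf.1.smul a, fun x => by
    rw [intervalIntegral.integral_const_mul, hf.2 x]
    ring⟩

/-- The product minus the candidate primitive is absolutely continuous with derivative zero almost
everywhere, hence constant. -/
theorem mul (hf : IsPrimitive f g) (hF : IsPrimitive F G) :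
    IsPrimitive (fun x => f x * F x) (fun x => g x * F x + f x * G x) := by
  have hli : LocallyIntegrable (fun x => g x * F x + f x * G x) volume :=
    (hf.1.mul_continuous hF.continuous).add (hF.1.continuous_mul hf.continuous)
  refine ⟨hli, fun x => ?_⟩
  have hac := ((hf.absolutelyContinuousOnInterval x).smul (hF.absolutelyContinuousOnInterval x)).sub
    ((hli.intervalIntegrable 0 x).absolutelyContinuousOnInterval_intervalIntegral_complex
      (c := 0) (by simp))
  obtain ⟨C, hC⟩ := hac.const_of_ae_hasDerivAt_zero (by
    filter_upwards [hf.ae_hasDerivAt, hF.ae_hasDerivAt,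
      LocallyIntegrable.ae_hasDerivAt_integral hli] with t h1 h2 h3 _
    simpa [add_comm] using (h1.mul h2).sub (h3 0))
  have h0 := hC 0 (by simp)
  have h1 := hC x (by simp)
  simp only [Pi.sub_apply, smul_eq_mul, Pi.mul_apply, intervalIntegral.integral_same,
    sub_zero] at h0 h1
  rw [h0, ← h1]
  ring

end IsPrimitive

/-! ### Solutions and their Wronskians -/

theorem deriv_conj_comp (u : ℝ → ℂ) (x : ℝ) :
    deriv (fun t => conj (u t)) x = conj (deriv u x) :=
  deriv.star

/-- The Wronskian `u v' - u' v`. -/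
noncomputable def wronskian (u v : ℝ → ℂ) (x : ℝ) : ℂ := u x * deriv v x - deriv u x * v x

namespace IsSolution

variable {q : ℝ → ℝ} {z w : ℂ} {u v : ℝ → ℂ}

theorem locallyIntegrable (hq : LocallyIntegrable q volume) (hu : IsSolution q z u) :
    LocallyIntegrable (fun t => ((q t : ℂ) - z) * u t) volume := by
  have h1 : LocallyIntegrable (fun t => (q t : ℂ)) volume := fun x => by
    obtain ⟨s, hs, h⟩ := hq x
    exact ⟨s, hs, h.ofReal⟩
  exact (h1.sub (locallyIntegrable_const z)).mul_continuous hu.1.continuous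

theorem isPrimitive_deriv (hq : LocallyIntegrable q volume) (hu : IsSolution q z u) :
    IsPrimitive (deriv u) (fun t => ((q t : ℂ) - z) * u t) :=
  ⟨hu.locallyIntegrable hq, hu.2⟩

theorem isPrimitive (hq : LocallyIntegrable q volume) (hu : IsSolution q z u) :
    IsPrimitive u (deriv u) :=
  .of_hasDerivAt (fun x => (hu.1 x).hasDerivAt) (hu.isPrimitive_deriv hq).continuous

/-- The terms with `q` cancel, so the almost everywhere derivative is continuous and is therefore a
derivative at every point. This is the source of differentiability at every `x` in the final result.
-/
theorem hasDerivAt_wronskian (hq : LocallyIntegrable q volume) (hu : IsSolution q z u)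
    (hv : IsSolution q w v) (x : ℝ) : HasDerivAt (wronskian u v) ((z - w) * (u x * v x)) x := by
  have h := (((hu.isPrimitive hq).mul (hv.isPrimitive_deriv hq)).sub
    ((hu.isPrimitive_deriv hq).mul (hv.isPrimitive hq))).congr_right
    (g' := fun x => (z - w) * (u x * v x)) (by ext t; ring)
  exact h.hasDerivAt (continuous_const.mul (hu.1.continuous.mul hv.1.continuous)) x

theorem wronskian_eq (hq : LocallyIntegrable q volume) (hu : IsSolution q z u)
    (hv : IsSolution q z v) (x : ℝ) : wronskian u v x = wronskian u v 0 :=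
  is_const_of_deriv_eq_zero (fun t => (hasDerivAt_wronskian hq hu hv t).differentiableAt)
    (fun t => by simpa using (hasDerivAt_wronskian hq hu hv t).deriv) x 0

theorem star (hu : IsSolution q z u) : IsSolution q (conj z) (fun x => conj (u x)) := by
  refine ⟨fun x => (hu.1 x).star, fun x => ?_⟩
  rw [deriv_conj_comp, deriv_conj_comp, hu.2 x, map_add]
  congr 1
  simp only [intervalIntegral, map_sub, ← integral_conj, map_mul, Complex.conj_ofReal]

end IsSolution

/-! ### The maximal operator and its symmetry -/

/-- Single-valuedness, needed for the operator built from `maximalGraph` to have it as its graph. -/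
theorem maximalGraph_snd_eq_zero (q : ℝ → ℝ)
    (p : Lp ℂ 2 (volume : Measure ℝ) × Lp ℂ 2 (volume : Measure ℝ)) (hp : p ∈ maximalGraph q)
    (h : p.1 = 0) : p.2 = 0 := by
  obtain ⟨y, w, hy, hw, hyw, hp1, hp2⟩ := hp
  have hy0 : y = 0 := by
    rw [← Continuous.ae_eq_iff_eq volume hy.continuous continuous_zero]
    rw [h] at hp1
    exact hp1.symm.trans (Lp.coeFn_zero ℂ 2 volume)
  subst hy0
  have hw0 : IsPrimitive (fun _ => 0) w := ⟨hw, fun x => by simpa using hyw x⟩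
  refine Lp.ext ((hp2.trans ?_).trans (Lp.coeFn_zero ℂ 2 volume).symm)
  filter_upwards [hw0.ae_hasDerivAt] with t ht
  simp [ht.unique (hasDerivAt_const t (0 : ℂ))]

/-- `y'` is locally absolutely continuous with almost everywhere derivative `w`, and both `y` and
`-w + q y` are square integrable. -/
structure IsMaximalDomainElement (q : ℝ → ℝ) (y w : ℝ → ℂ) : Prop where
  differentiable : Differentiable ℝ y
  isPrimitive : IsPrimitive (deriv y) w
  memLp : MemLp y 2 volume
  memLp_image : MemLp (fun t => -w t + (q t : ℂ) * y t) 2 volume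

theorem IsMaximalDomainElement.mem_graph {q : ℝ → ℝ} {y w : ℝ → ℂ}
    (h : IsMaximalDomainElement q y w) :
    (h.memLp.toLp y, h.memLp_image.toLp _) ∈ (sturmLiouvilleOperator q).graph := by
  rw [sturmLiouvilleOperator, Submodule.toLinearPMap_graph_eq _ (maximalGraph_snd_eq_zero q)]
  exact ⟨y, w, h.differentiable, h.isPrimitive.1, h.isPrimitive.2, h.memLp.coeFn_toLp,
    h.memLp_image.coeFn_toLp⟩

theorem integral_conj_mul_image_eq {q : ℝ → ℝ} (hL : IsSelfAdjoint (sturmLiouvilleOperator q))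
    {y w Y W : ℝ → ℂ} (h : IsMaximalDomainElement q y w) (H : IsMaximalDomainElement q Y W) :
    ∫ t, conj (-w t + (q t : ℂ) * y t) * Y t = ∫ t, conj (y t) * (-W t + (q t : ℂ) * Y t) := by
  obtain ⟨a, ha, ha'⟩ := (LinearPMap.mem_graph_iff _).1 h.mem_graph
  obtain ⟨b, hb, hb'⟩ := (LinearPMap.mem_graph_iff _).1 H.mem_graph
  have key := LinearPMap.adjoint_isFormalAdjoint hL.dense_domain
  rw [LinearPMap.isSelfAdjoint_def.1 hL] at key
  have key := key a b
  rw [ha', hb', ha, hb, L2.inner_def, L2.inner_def] at key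
  simp only [RCLike.inner_apply] at key
  refine Eq.trans (integral_congr_ae ?_) (key.trans (integral_congr_ae ?_))
  · filter_upwards [h.memLp_image.coeFn_toLp, H.memLp.coeFn_toLp] with t h1 h2
    rw [h1, h2, mul_comm]
  · filter_upwards [h.memLp.coeFn_toLp, H.memLp_image.coeFn_toLp] with t h1 h2
    rw [h1, h2, mul_comm]

/-! ### Cutoffs and vanishing of the Wronskian at infinity -/

/-- A smooth function vanishing on `(-∞, 0]` and equal to `1` on `[1, ∞)`. -/
noncomputable def cutoff (x : ℝ) : ℂ := (Real.smoothTransition x : ℂ)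

theorem contDiff_cutoff {n : ℕ∞} : ContDiff ℝ n cutoff :=
  Complex.ofRealCLM.contDiff.comp Real.smoothTransition.contDiff

theorem conj_cutoff (x : ℝ) : conj (cutoff x) = cutoff x := Complex.conj_ofReal _

theorem cutoff_of_nonpos {x : ℝ} (hx : x ≤ 0) : cutoff x = 0 := by
  simp [cutoff, Real.smoothTransition.zero_of_nonpos hx]

theorem cutoff_of_one_le {x : ℝ} (hx : 1 ≤ x) : cutoff x = 1 := by
  simp [cutoff, Real.smoothTransition.one_of_one_le hx]

theorem norm_cutoff_le (x : ℝ) : ‖cutoff x‖ ≤ 1 := by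
  rw [cutoff, Complex.norm_real, Real.norm_of_nonneg (Real.smoothTransition.nonneg x)]
  exact Real.smoothTransition.le_one x

theorem hasDerivAt_cutoff (x : ℝ) : HasDerivAt cutoff (deriv cutoff x) x :=
  ((contDiff_cutoff (n := 1)).differentiable (by simp) x).hasDerivAt

theorem contDiff_deriv_cutoff : ContDiff ℝ 1 (deriv cutoff) :=
  ((contDiff_succ_iff_deriv (n := 1)).1 (contDiff_cutoff (n := 2))).2.2

theorem hasDerivAt_deriv_cutoff (x : ℝ) :
    HasDerivAt (deriv cutoff) (deriv (deriv cutoff) x) x :=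
  (contDiff_deriv_cutoff.differentiable (by simp) x).hasDerivAt

theorem continuous_deriv_deriv_cutoff : Continuous (deriv (deriv cutoff)) :=
  contDiff_deriv_cutoff.continuous_deriv (by simp)

theorem deriv_cutoff_of_notMem {x : ℝ} (hx : x ∉ Icc (0 : ℝ) 1) : deriv cutoff x = 0 := by
  have : ∃ a : ℂ, cutoff =ᶠ[𝓝 x] fun _ => a := by
    rcases lt_or_ge x 0 with h | h
    · exact ⟨0, by filter_upwards [Iio_mem_nhds h] with t ht using cutoff_of_nonpos ht.le⟩
    · have h1 : 1 < x := lt_of_not_ge fun h1 => hx ⟨h, h1⟩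
      exact ⟨1, by filter_upwards [Ioi_mem_nhds h1] with t ht using cutoff_of_one_le ht.le⟩
  obtain ⟨a, ha⟩ := this
  simpa using ha.deriv_eq

theorem hasCompactSupport_deriv_cutoff : HasCompactSupport (deriv cutoff) :=
  .intro isCompact_Icc fun _ hx => deriv_cutoff_of_notMem hx

namespace IsSolution

variable {q : ℝ → ℝ} {z w : ℂ} {u v : ℝ → ℂ}

theorem memLp_Ioi (hu : IsSolution q z u) {a b : ℝ}
    (hL2 : MemLp u 2 (volume.restrict (Ioi a))) : MemLp u 2 (volume.restrict (Ioi b)) := by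
  rcases le_total a b with h | h
  · exact hL2.mono_measure (Measure.restrict_mono (Ioi_subset_Ioi h) le_rfl)
  · have hm : ∀ μ : Measure ℝ, AEStronglyMeasurable u μ := fun _ =>
      hu.1.continuous.aestronglyMeasurable
    rw [memLp_two_iff_integrable_sq_norm (hm _)] at hL2 ⊢
    rw [← Ioc_union_Ioi_eq_Ioi h]
    exact ((hu.1.continuous.norm.pow 2).integrableOn_Ioc).union hL2

/-- The image of `cutoff * u` is `z * cutoff * u` up to terms containing derivatives of the cutoff;
these are continuous with compact support. -/
theorem isMaximalDomainElement_cutoff_mul (hq : LocallyIntegrable q volume)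
    (hu : IsSolution q z u) (hL2 : MemLp u 2 (volume.restrict (Ioi 0))) :
    IsMaximalDomainElement q (fun x => cutoff x * u x)
      (fun x => deriv (deriv cutoff) x * u x + 2 * (deriv cutoff x * deriv u x) +
        cutoff x * (((q x : ℂ) - z) * u x)) := by
  have hk : IsPrimitive cutoff (deriv cutoff) :=
    .of_hasDerivAt hasDerivAt_cutoff contDiff_deriv_cutoff.continuous
  have hk' : IsPrimitive (deriv cutoff) (deriv (deriv cutoff)) :=
    .of_hasDerivAt hasDerivAt_deriv_cutoff continuous_deriv_deriv_cutoff
  have hd : ∀ x, HasDerivAt (fun x => cutoff x * u x)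
      (deriv cutoff x * u x + cutoff x * deriv u x) x := fun x =>
    (hasDerivAt_cutoff x).mul (hu.1 x).hasDerivAt
  have hmem : MemLp (fun x => cutoff x * u x) 2 volume := by
    have h1 : MemLp ((Ioi (0 : ℝ)).indicator u) 2 volume :=
      (memLp_indicator_iff_restrict measurableSet_Ioi).2 hL2
    refine h1.mono (hk.continuous.mul hu.1.continuous).aestronglyMeasurable (.of_forall fun x => ?_)
    by_cases hx : 0 < x
    · rw [indicator_of_mem (mem_Ioi.2 hx), norm_mul]
      exact mul_le_of_le_one_left (norm_nonneg _) (norm_cutoff_le x)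
    · simp [cutoff_of_nonpos (not_lt.1 hx)]
  have hu' := (hu.isPrimitive_deriv hq).continuous
  have hsupp : MemLp (fun x => deriv (deriv cutoff) x * u x + 2 * (deriv cutoff x * deriv u x)) 2
      volume := by
    refine Continuous.memLp_of_hasCompactSupport ?_ ?_
    · exact (continuous_deriv_deriv_cutoff.mul hu.1.continuous).add
        (continuous_const.mul (hk'.continuous.mul hu'))
    · exact (hasCompactSupport_deriv_cutoff.deriv.mul_right).add
        (hasCompactSupport_deriv_cutoff.mul_right.mul_left)
  refine ⟨fun x => (hd x).differentiableAt, ?_, hmem, ?_⟩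
  · rw [funext fun x => (hd x).deriv]
    refine ((hk'.mul (hu.isPrimitive hq)).add (hk.mul (hu.isPrimitive_deriv hq))).congr_right ?_
    ext x
    ring
  · refine ((hmem.const_mul z).sub hsupp).ae_eq (.of_forall fun x => ?_)
    simp only [Pi.sub_apply]
    ring

/-- The Wronskian of two solutions that are square integrable at `+∞` vanishes at `+∞`, as an
identity for its integrated derivative. -/
theorem integral_Ioi_mul (hq : LocallyIntegrable q volume)
    (hL : IsSelfAdjoint (sturmLiouvilleOperator q)) (hu : IsSolution q z u) (hv : IsSolution q w v)
    (hu2 : MemLp u 2 (volume.restrict (Ioi 0))) (hv2 : MemLp v 2 (volume.restrict (Ioi 0)))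
    (x : ℝ) : (z - w) * ∫ t in Ioi x, u t * v t = -wronskian u v x := by
  have hint : ∀ x, IntegrableOn (fun t => (z - w) * (u t * v t)) (Ioi x) volume := fun x =>
    ((hu.memLp_Ioi hu2).integrable_mul (hv.memLp_Ioi hv2)).const_mul _
  have hW := hasDerivAt_wronskian hq hu hv
  -- The derivative is integrable as a product of two square integrable functions, so the Wronskian
  -- has some limit; only its value remains to be found.
  have hlim := tendsto_limUnder_of_hasDerivAt_of_integrableOn_Ioi (fun x _ => hW x) (hint 0)
  generalize limUnder atTop (wronskian u v) = l at hlim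
  suffices hl : l = 0 by
    have := integral_Ioi_of_hasDerivAt_of_tendsto' (fun x _ => hW x) (hint x) hlim
    rw [integral_const_mul] at this
    rw [this, hl, zero_sub]
  -- The inner product conjugates its first argument, so symmetry is tested on `cutoff * conj v` and
  -- `cutoff * u`.
  have hv' := hv.star
  have hv2' : MemLp (fun x => conj (v x)) 2 (volume.restrict (Ioi 0)) := hv2.star
  have hmu := hu.isMaximalDomainElement_cutoff_mul hq hu2
  have hmv := hv'.isMaximalDomainElement_cutoff_mul hq hv2'
  have hsym := integral_conj_mul_image_eq hL hmv hmu
  have hk' : ∀ x, conj (deriv cutoff x) = deriv cutoff x := fun x => by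
    rw [← deriv_conj_comp, funext conj_cutoff]
  have hk'' : ∀ x, conj (deriv (deriv cutoff) x) = deriv (deriv cutoff) x := fun x => by
    rw [← deriv_conj_comp, funext hk']
  have hi1 := hmv.memLp_image.star.integrable_mul hmu.memLp
  have hi2 := hmv.memLp.star.integrable_mul hmu.memLp_image
  have hP : ∀ x, HasDerivAt (fun x => cutoff x ^ 2 * wronskian u v x)
      (2 * cutoff x * deriv cutoff x * wronskian u v x +
        cutoff x ^ 2 * ((z - w) * (u x * v x))) x := fun x => by
    convert! ((hasDerivAt_cutoff x).pow 2).mul (hW x) using 1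
    simp
  have hbot : Tendsto (fun x => cutoff x ^ 2 * wronskian u v x) atBot (𝓝 0) := by
    refine tendsto_const_nhds.congr' ?_
    filter_upwards [eventually_le_atBot 0] with x hx
    simp [cutoff_of_nonpos hx]
  have htop : Tendsto (fun x => cutoff x ^ 2 * wronskian u v x) atTop (𝓝 l) := by
    refine hlim.congr' ?_
    filter_upwards [eventually_ge_atTop 1] with x hx
    simp [cutoff_of_one_le hx]
  -- The Lagrange identity: `cutoff ^ 2 * W(u, v)` is the Wronskian of `cutoff * u` and `cutoff *
  -- v`. It runs from `0` to `l`, while symmetry makes the integral of its derivative zero.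
  have heq : ∀ x, conj (cutoff x * conj (v x)) *
      (-(deriv (deriv cutoff) x * u x + 2 * (deriv cutoff x * deriv u x) +
        cutoff x * (((q x : ℂ) - z) * u x)) + (q x : ℂ) * (cutoff x * u x)) -
      conj (-(deriv (deriv cutoff) x * conj (v x) +
        2 * (deriv cutoff x * deriv (fun x => conj (v x)) x) +
        cutoff x * (((q x : ℂ) - conj w) * conj (v x))) + (q x : ℂ) * (cutoff x * conj (v x))) *
      (cutoff x * u x) = 2 * cutoff x * deriv cutoff x * wronskian u v x +
        cutoff x ^ 2 * ((z - w) * (u x * v x)) := fun x => by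
    simp only [map_add, map_mul, map_neg, map_sub, deriv_conj_comp, Complex.conj_conj, hk', hk'',
      conj_cutoff, Complex.conj_ofReal, map_ofNat, wronskian]
    ring
  have hD := integral_of_hasDerivAt_of_tendsto hP ((hi2.sub hi1).congr (.of_forall heq)) hbot htop
  rw [← sub_zero l, ← hD, ← integral_congr_ae (.of_forall heq)]
  exact (integral_sub hi2 hi1).trans (sub_eq_zero.2 hsym.symm)

end IsSolution

/-! ### The Weyl solution and the normalization -/

section FundamentalSystem

variable {q : ℝ → ℝ} {z : ℂ} {u v : ℝ → ℂ}

theorem IsSolution.deriv_mul_const_add (hu : IsSolution q z u) (hv : IsSolution q z v) (a : ℂ)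
    (x : ℝ) : deriv (fun t => u t * a + v t) x = deriv u x * a + deriv v x :=
  (((hu.1 x).hasDerivAt.mul_const a).add (hv.1 x).hasDerivAt).deriv

theorem IsSolution.mul_const_add (hq : LocallyIntegrable q volume) (hu : IsSolution q z u)
    (hv : IsSolution q z v) (a : ℂ) : IsSolution q z (fun t => u t * a + v t) := by
  refine ⟨(hu.1.mul_const a).add hv.1, ?_⟩
  rw [funext (hu.deriv_mul_const_add hv a)]
  have h : IsPrimitive _ (fun t => ((q t : ℂ) - z) * (u t * a + v t)) :=
    (((hu.isPrimitive_deriv hq).const_mul a).add (hv.isPrimitive_deriv hq)).congr_right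
      (by ext t; ring)
  simpa only [mul_comm a] using h.eq_add_integral

variable {c s : ℝ → ℂ → ℂ} {m : ℂ → ℂ} {l : ℂ}

/-- The Weyl-type solution `c(·, λ) a + s(·, λ)`. -/
noncomputable def weylSolution (c s : ℝ → ℂ → ℂ) (l a : ℂ) (x : ℝ) : ℂ := c x l * a + s x l

theorem IsFundamentalSystem.isSolution_weylSolution (hcs : IsFundamentalSystem q c s)
    (hq : LocallyIntegrable q volume) (l a : ℂ) : IsSolution q (l ^ 2) (weylSolution c s l a) :=
  (hcs l).1.1.mul_const_add hq (hcs l).2.1 a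

theorem IsFundamentalSystem.deriv_weylSolution (hcs : IsFundamentalSystem q c s) (l a : ℂ) (x : ℝ) :
    deriv (weylSolution c s l a) x =
      deriv (fun t => c t l) x * a + deriv (fun t => s t l) x :=
  (hcs l).1.1.deriv_mul_const_add (hcs l).2.1 a x

theorem IsFundamentalSystem.weylSolution_zero (hcs : IsFundamentalSystem q c s) (l a : ℂ) :
    weylSolution c s l a 0 = a := by
  simp [weylSolution, (hcs l).1.2.1, (hcs l).2.2.1]

theorem IsFundamentalSystem.deriv_weylSolution_zero (hcs : IsFundamentalSystem q c s) (l a : ℂ) :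
    deriv (weylSolution c s l a) 0 = 1 := by
  rw [hcs.deriv_weylSolution, (hcs l).1.2.2, (hcs l).2.2.2]
  simp

/-- Constancy of the Wronskians of `u`, `c`, `s` gives the expansion by Cramer's rule, without a
uniqueness theorem. -/
theorem IsFundamentalSystem.eq_add (hcs : IsFundamentalSystem q c s)
    (hq : LocallyIntegrable q volume) (hu : IsSolution q (l ^ 2) u) (x : ℝ) :
    u x = u 0 * c x l + deriv u 0 * s x l := by
  obtain ⟨⟨hc, hc0, hc1⟩, hs, hs0, hs1⟩ := hcs l
  have h1 := hu.wronskian_eq hq hc x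
  have h2 := hu.wronskian_eq hq hs x
  have h3 := hc.wronskian_eq hq hs x
  simp only [wronskian, hc0, hc1, hs0, hs1] at h1 h2 h3
  linear_combination (-u x) * h3 + c x l * h2 - s x l * h1

/-- Under self-adjointness, the solutions that are square integrable at `+∞` are the multiples of
the Weyl solution. -/
theorem eq_deriv_mul_weylSolution (hq : LocallyIntegrable q volume)
    (hL : IsSelfAdjoint (sturmLiouvilleOperator q)) (hcs : IsFundamentalSystem q c s) {a : ℂ}
    (ha : MemLp (weylSolution c s l a) 2 (volume.restrict (Ioi 0)))
    (hu : IsSolution q (l ^ 2) u) (hu2 : MemLp u 2 (volume.restrict (Ioi 0))) (x : ℝ) :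
    u x = deriv u 0 * weylSolution c s l a x := by
  -- Both spectral parameters are equal, so this says that the Wronskian at `0` vanishes.
  have h := hu.integral_Ioi_mul hq hL (hcs.isSolution_weylSolution hq l a) hu2 ha 0
  simp only [wronskian, hcs.weylSolution_zero, hcs.deriv_weylSolution_zero] at h
  rw [hcs.eq_add hq hu x, weylSolution]
  linear_combination c x l * h

/-- The squared norm in `L²(x, ∞)` of a function. -/
noncomputable def tailNormSq (u : ℝ → ℂ) (x : ℝ) : ℝ := ∫ t in Ioi x, ‖u t‖ ^ 2

theorem tailNormSq_nonneg (u : ℝ → ℂ) (x : ℝ) : 0 ≤ tailNormSq u x :=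
  integral_nonneg fun _ => by positivity

/-- Here `u` is `r` times the Weyl solution, so unit norm reads `r ^ 2 * tailNormSq = 1`. This
yields positivity and the value of `r` at once. -/
theorem tailNormSq_pos_and_eq (hq : LocallyIntegrable q volume)
    (hL : IsSelfAdjoint (sturmLiouvilleOperator q)) (hcs : IsFundamentalSystem q c s) {a : ℂ}
    (ha : MemLp (weylSolution c s l a) 2 (volume.restrict (Ioi 0)))
    (hu : IsSolution q (l ^ 2) u) {x : ℝ} (hu2 : MemLp u 2 (volume.restrict (Ioi x)))
    (hu1 : ∫ t in Ioi x, ‖u t‖ ^ 2 = 1) {r : ℝ} (hr : 0 < r) (hur : deriv u 0 = r) :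
    0 < tailNormSq (weylSolution c s l a) x ∧
      u = fun t => ((√(tailNormSq (weylSolution c s l a) x))⁻¹ : ℝ) * weylSolution c s l a t := by
  have h := eq_deriv_mul_weylSolution hq hL hcs ha hu (hu.memLp_Ioi hu2)
  have h1 : r ^ 2 * tailNormSq (weylSolution c s l a) x = 1 := by
    rw [← hu1, tailNormSq, ← integral_const_mul]
    refine integral_congr_ae (.of_forall fun t => ?_)
    simp only [h t, hur, norm_mul, Complex.norm_real, Real.norm_of_nonneg hr.le, mul_pow]
  have h2 : tailNormSq (weylSolution c s l a) x = (r ^ 2)⁻¹ :=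
    eq_inv_of_mul_eq_one_right h1
  refine ⟨by rw [h2]; positivity, funext fun t => ?_⟩
  rw [h2, Real.sqrt_inv, Real.sqrt_sq hr.le, inv_inv, ← hur]
  exact h t

end FundamentalSystem

/-! ### The tail norm as a Wronskian -/

section WeylSolution

variable {q : ℝ → ℝ} {z : ℂ} {u : ℝ → ℂ}

theorem IsSolution.wronskian_star (hq : LocallyIntegrable q volume)
    (hL : IsSelfAdjoint (sturmLiouvilleOperator q)) (hu : IsSolution q z u)
    (hu2 : MemLp u 2 (volume.restrict (Ioi 0))) (x : ℝ) :
    (z - conj z) * tailNormSq u x = deriv u x * conj (u x) - u x * conj (deriv u x) := by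
  have h := hu.integral_Ioi_mul hq hL hu.star hu2 hu2.star x
  rw [wronskian, deriv_conj_comp, neg_sub] at h
  rw [← h, tailNormSq, ← integral_complex_ofReal]
  congr 1
  refine integral_congr_ae (.of_forall fun t => ?_)
  simp [Complex.mul_conj']

/-- For nonreal `z` the tail norm is a constant multiple of the Wronskian of `u` and `conj u`, which
is differentiable everywhere. -/
theorem IsSolution.hasDerivAt_tailNormSq (hq : LocallyIntegrable q volume)
    (hL : IsSelfAdjoint (sturmLiouvilleOperator q)) (hu : IsSolution q z u)
    (hu2 : MemLp u 2 (volume.restrict (Ioi 0))) (hz : z - conj z ≠ 0) (x : ℝ) :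
    HasDerivAt (tailNormSq u) (-‖u x‖ ^ 2) x := by
  have h1 := (hu.hasDerivAt_wronskian hq hu.star x).const_mul (-(z - conj z)⁻¹)
  have h2 : (fun x => -(z - conj z)⁻¹ * wronskian u (fun t => conj (u t)) x) =
      fun x => (tailNormSq u x : ℂ) := by
    ext t
    have := hu.wronskian_star hq hL hu2 t
    rw [wronskian, deriv_conj_comp]
    field_simp
    linear_combination -this
  rw [h2] at h1
  have h3 := Complex.reCLM.hasFDerivAt.comp_hasDerivAt x h1
  convert! h3 using 1
  rw [Complex.mul_conj']
  field_simp
  simp [← Complex.ofReal_pow]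

end WeylSolution

/-- The quotient rule for `J / (D I)` has numerator `D conj p (f D I + p J)`, which `h` turns into
`D² I₀ (conj p)²`. -/
theorem hasDerivWithRespectTo_of_wronskian {I : ℝ → ℝ} {J : ℝ → ℂ} {x : ℝ} {D p f : ℂ} {I₀ : ℝ}
    (hD : D ≠ 0) (hI₀ : I₀ ≠ 0) (hIx : I x ≠ 0) (hp : p ≠ 0) (hI : HasDerivAt I (-‖p‖ ^ 2) x)
    (hJ : HasDerivAt J (D * (conj p * f)) x)
    (h : p * J x + f * (D * I x) = D * I₀ * conj p) :
    HasDerivWithRespectTo (fun t => J t / (D * I t)) (fun t => I₀ / I t) (conj p / p) x := by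
  have hIc : (I x : ℂ) ≠ 0 := by exact_mod_cast hIx
  have hI₀c : (I₀ : ℂ) ≠ 0 := by exact_mod_cast hI₀
  have hn : ‖p‖ ≠ 0 := norm_ne_zero_iff.2 hp
  have hnc : (‖p‖ : ℂ) ≠ 0 := by exact_mod_cast hn
  have hpc : conj p ≠ 0 := (map_ne_zero _).2 hp
  refine ⟨_, _, hJ.div (hI.ofReal_comp.const_mul D) (mul_ne_zero hD hIc),
    (hasDerivAt_const x I₀).div hI hIx, ?_, ?_⟩
  · field_simp
    simpa [hI₀, hn] using hIx
  · have hpp := Complex.mul_conj' p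
    push_cast
    rw [← hpp]
    field_simp
    linear_combination (-p) * h

end SturmLiouville

/-! ### The normalized transfer matrix and the differential equation for `a` -/

open SturmLiouville

theorem mainTheorem10
    (q : ℝ → ℝ) (hq : MeasureTheory.LocallyIntegrable q MeasureTheory.volume)
    (hL : IsSelfAdjoint (SturmLiouville.sturmLiouvilleOperator q))
    (c s : ℝ → ℂ → ℂ) (hcs : SturmLiouville.IsFundamentalSystem q c s)
    (m : ℂ → ℂ) (hm : SturmLiouville.IsWeylFunction c s m)
    (e : ℝ → ℝ → ℂ → ℂ) (he : SturmLiouville.IsNormalizedWeylSolution q e)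
    (l₀ : ℂ) (hre : 0 < l₀.re) (him : 0 < l₀.im) :
    ∃ (τ : ℝ → ℝ) (a : ℝ → ℂ),
      (∀ x : ℝ, 0 < x → 0 < τ x ∧
        SturmLiouville.normalizedTransferMatrix c s e l₀ x l₀ =
          !![(τ x : ℂ), a x * (τ x : ℂ); 0, (τ x : ℂ)⁻¹]) ∧
      ∀ x : ℝ, 0 < x →
        c x l₀ * m l₀ + s x l₀ ≠ 0 ∧
        SturmLiouville.HasDerivWithRespectTo a (fun t => (τ t ^ 2)⁻¹)
          ((starRingEnd ℂ (c x l₀) * starRingEnd ℂ (m l₀) + starRingEnd ℂ (s x l₀)) /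
            (c x l₀ * m l₀ + s x l₀)) x := by
  have hψ2 : MemLp (weylSolution c s l₀ (m l₀)) 2 (volume.restrict (Ioi 0)) := hm l₀ him hre.ne'
  have hψ := hcs.isSolution_weylSolution hq l₀ (m l₀)
  have hφ := hcs.isSolution_weylSolution hq l₀ (conj (m l₀))
  have hφd := hcs.deriv_weylSolution l₀ (conj (m l₀))
  have hψd := hcs.deriv_weylSolution l₀ (m l₀)
  have hψ0 := hcs.weylSolution_zero l₀ (m l₀)
  have hφ0 := hcs.weylSolution_zero l₀ (conj (m l₀))
  have hψd0 := hcs.deriv_weylSolution_zero l₀ (m l₀)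
  have hφd0 := hcs.deriv_weylSolution_zero l₀ (conj (m l₀))
  have hE : ∀ x, 0 ≤ x → 0 < tailNormSq (weylSolution c s l₀ (m l₀)) x ∧
      (fun t => e x t l₀) = fun t => ((√(tailNormSq (weylSolution c s l₀ (m l₀)) x))⁻¹ : ℝ) *
        weylSolution c s l₀ (m l₀) t := fun x hx => by
    obtain ⟨h1, h2, h3, r, hr, h4⟩ := he x hx l₀ him hre.ne'
    exact tailNormSq_pos_and_eq hq hL hcs hψ2 h1 h2 h3 hr h4
  have hE' : ∀ x, 0 ≤ x → (fun t => e x t (-(conj l₀))) = fun t =>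
      ((√(tailNormSq (weylSolution c s l₀ (m l₀)) x))⁻¹ : ℝ) *
        conj (weylSolution c s l₀ (m l₀) t) := fun x hx => by
    obtain ⟨h1, h2, h3, r, hr, h4⟩ := he x hx (-(conj l₀)) (by simpa using him)
      (by simpa using hre.ne')
    -- Since `conj ((-conj λ₀)²) = λ₀²`, conjugation reduces to the parameter `λ₀`; the positive
    -- derivative at `0` is real, so it survives conjugation.
    have h := (tailNormSq_pos_and_eq (u := fun t => conj (e x t (-(conj l₀)))) hq hL hcs hψ2
      (by simpa using h1.star) h2.star (by simpa using h3) hr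
      (by rw [deriv_conj_comp, h4, Complex.conj_ofReal])).2
    ext t
    have := congrArg conj (congrFun h t)
    simpa using this
  have hD : l₀ ^ 2 - conj (l₀ ^ 2) ≠ 0 := by
    intro h
    have := congrArg Complex.im h
    simp [pow_two] at this
    nlinarith [mul_pos hre him]
  have hInn : ∀ x, 0 ≤ tailNormSq (weylSolution c s l₀ (m l₀)) x := tailNormSq_nonneg _
  have hW := hψ.wronskian_star hq hL hψ2
  have hI := hψ.hasDerivAt_tailNormSq hq hL hψ2 hD
  have hJ := hφ.hasDerivAt_wronskian hq hψ.star
  have hWφ := hφ.wronskian_eq hq hψ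
  generalize hψe : weylSolution c s l₀ (m l₀) = ψ at *
  generalize hφe : weylSolution c s l₀ (conj (m l₀)) = φ at *
  generalize hIe : tailNormSq ψ = I at *
  generalize hDe : l₀ ^ 2 - conj (l₀ ^ 2) = D at *
  have hW0 := hW 0
  simp only [wronskian, hψ0, hφ0, hψd0, hφd0] at hWφ hW0
  have hne : ∀ x, 0 ≤ x → (I x : ℂ) ≠ 0 := fun x hx => by exact_mod_cast (hE x hx).1.ne'
  have hψne : ∀ x, 0 ≤ x → ψ x ≠ 0 := fun x hx h => by
    have := hW x
    simp only [h, map_zero, mul_zero, zero_mul, sub_zero, mul_eq_zero] at this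
    exact this.elim hD (hne x hx)
  -- Expansion of `φ` in `ψ` and `conj ψ`. The right-hand constant is `W(φ, ψ) = conj m - m`, which
  -- is `D * I 0` by the Wronskian identity at `0`.
  have key : ∀ x, ψ x * wronskian φ (fun t => conj (ψ t)) x + φ x * (D * I x) =
      D * I 0 * conj (ψ x) := fun x => by
    rw [hW x, hW0, wronskian, deriv_conj_comp, map_one]
    linear_combination conj (ψ x) * hWφ x
  have key' : ∀ x, deriv ψ x * wronskian φ (fun t => conj (ψ t)) x + deriv φ x * (D * I x) =
      D * I 0 * conj (deriv ψ x) := fun x => by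
    rw [hW x, hW0, wronskian, deriv_conj_comp, map_one]
    linear_combination conj (deriv ψ x) * hWφ x
  refine ⟨fun x => √(I x) / √(I 0), fun x => wronskian φ (fun t => conj (ψ t)) x / (D * I x),
    fun x hx => ⟨?_, ?_⟩, fun x hx => ⟨?_, ?_⟩⟩
  · have h1 := (hE x hx.le).1
    have h2 := (hE 0 le_rfl).1
    positivity
  · have hdE : ∀ x, 0 ≤ x → boundaryMatrix e l₀ x = ((√(I x))⁻¹ : ℂ) •
        !![ψ x, -conj (ψ x); deriv ψ x, -conj (deriv ψ x)] := fun x hx => by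
      have h1 : ∀ t, e x t l₀ = _ := congrFun (hE x hx).2
      have h2 : ∀ t, e x t (-(conj l₀)) = _ := congrFun (hE' x hx)
      rw [boundaryMatrix, (hE x hx).2, hE' x hx, h1, h2, deriv_const_mul_field,
        deriv_const_mul_field, deriv_conj_comp]
      simp [Matrix.smul_of]
    obtain ⟨hIx, -⟩ := hE x hx.le
    obtain ⟨hI0, -⟩ := hE 0 le_rfl
    have hr : (√(I x) : ℂ) ≠ 0 := by exact_mod_cast (Real.sqrt_pos.2 hIx).ne'
    have hr0 : (√(I 0) : ℂ) ≠ 0 := by exact_mod_cast (Real.sqrt_pos.2 hI0).ne'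
    have hr2 : (√(I x) : ℂ) ^ 2 = I x := by exact_mod_cast Real.sq_sqrt hIx.le
    have hr02 : (√(I 0) : ℂ) ^ 2 = I 0 := by exact_mod_cast Real.sq_sqrt hI0.le
    -- Up to the nonzero scalar factor, the determinant is the Wronskian expression equal to `D * I
    -- x`.
    have hdet : IsUnit (boundaryMatrix e l₀ x).det := by
      rw [hdE x hx.le, Matrix.det_smul, Matrix.det_fin_two_of, isUnit_iff_ne_zero]
      refine mul_ne_zero (by simp [hr]) ?_
      have := mul_ne_zero hD (hne x hx.le)
      rw [hW x] at this
      convert this using 1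
      ring
    -- Multiplying by the boundary matrix on the left avoids computing its inverse; the second
    -- column is `key` and `key'`.
    have hB : transferMatrix c s x l₀ * boundaryMatrix e l₀ 0 = boundaryMatrix e l₀ x *
        !![((√(I x) / √(I 0) : ℝ) : ℂ), wronskian φ (fun t => conj (ψ t)) x / (D * I x) *
          ((√(I x) / √(I 0) : ℝ) : ℂ); 0, ((√(I x) / √(I 0) : ℝ) : ℂ)⁻¹] := by
      have k := key x
      have k' := key' x
      have hIx := hne x hx.le
      have e1 : c x l₀ * m l₀ + s x l₀ = ψ x := by rw [← hψe, weylSolution]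
      have e2 : c x l₀ * conj (m l₀) + s x l₀ = φ x := by rw [← hφe, weylSolution]
      have e3 := hψd x
      have e4 := hφd x
      rw [← hr2] at hIx k k' ⊢
      rw [← hr02] at k k'
      rw [hdE x hx.le, hdE 0 le_rfl, transferMatrix, hψ0, hψd0]
      ext i j
      fin_cases i <;> fin_cases j
      · simp [Matrix.mul_apply, Fin.sum_univ_two]
        field_simp
        linear_combination e1
      · simp [Matrix.mul_apply, Fin.sum_univ_two]
        field_simp
        linear_combination (-√(I x) ^ 2 * D) * e2 - k
      · simp [Matrix.mul_apply, Fin.sum_univ_two]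
        field_simp
        linear_combination -e3
      · simp [Matrix.mul_apply, Fin.sum_univ_two]
        field_simp
        linear_combination (√(I x) ^ 2 * D) * e4 - k'
    rw [normalizedTransferMatrix, Matrix.mul_assoc, hB, Matrix.nonsing_inv_mul_cancel_left _ _ hdet]
  · have := hψne x hx.le
    rwa [← hψe] at this
  · have := hasDerivWithRespectTo_of_wronskian hD (hE 0 le_rfl).1.ne' (hE x hx.le).1.ne'
      (hψne x hx.le) (hI x) ((hJ x).congr_deriv (by ring)) (key x)
    rw [← map_mul, ← map_add]
    have e1 : c x l₀ * m l₀ + s x l₀ = ψ x := by rw [← hψe, weylSolution]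
    rw [e1]
    convert! this using 2 with t
    rw [div_pow, Real.sq_sqrt (hInn t), Real.sq_sqrt (hInn 0), inv_div]
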